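/- All graphs are finite, without loops, and with at most one edge (directed or undirected) between two vertices. A path is a sequence of distinct vertices in which consecutive vertices are adjacent. It is partially directed if no edge between consecutive vertices points backwards, directed if each of these edges is directed and points forwards, and chordless if no edge joins two nonconsecutive vertices of it. Two DAGs on the same vertex set are Markov equivalent if they induce the same d-separation relations. The CPDAG of a DAG $\mathcal G_0$ is the partially directed acyclic graph $\mathcal G^*$ with the same skeleton as $\mathcal G_0$ in which an edge is directed (and then with the given direction) if and only if this directed edge appears in all DAGs that are Markov equivalent to $\mathcal G_0$; $[\mathcal G^*]$ denotes the Markov equivalence class of $\mathcal G_0$. In a DAG, $X$ is a direct cause of $Y$ if $X\to Y$, and $X$ is a cause of $Y$ if there is a directed path from $X$ to $Y$ or $X=Y$. For a vertex $T$ and a vertex set $\mathbf H\not\ni T$, the direct causal clause (DCC) $T\xrightarrow{or}\mathbf H$ holds for a DAG $\mathcal G$ if at least one vertex of $\mathbf H$ is a child of $T$ in $\mathcal G$ (so it fails if $\mathbf H=\varnothing$); $T\xrightarrow{or}D$ stands for $T\xrightarrow{or}\{D\}$. For distinct vertices $X,Y$, the critical set $\mathbf C_{XY}(\mathcal G^*)$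 consists of all vertices adjacent to $X$ in $\mathcal G^*$ (by a directed or an undirected edge) that lie on at least one chordless partially directed path from $X$ to $Y$ in $\mathcal G^*$. Theorem. Let $\mathcal G^*$ be a CPDAG, let $X\neq Y$ be vertices of $\mathcal G^*$, and let $\mathcal G\in[\mathcal G^*]$. Then - (i) $X$ is a direct cause of $Y$ in $\mathcal G$ if and only if $X\xrightarrow{or}Y$ holds for $\mathcal G$; - (ii) $X$ is a cause of $Y$ in $\mathcal G$ if and only if $X\xrightarrow{or}\mathbf C_{XY}(\mathcal G^*)$ holds for $\mathcal G$; - (iii) $X$ is not a cause of $Y$ in $\mathcal G$ if and only if $C\xrightarrow{or}X$ holds for $\mathcal G$ for every $C\in\mathbf C_{XY}(\mathcal G^*)$. -/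

import Mathlib

/-- A partially directed graph with vertex set `V`: `dir a b` is the directed edge `a → b`,
`undir a b` is the undirected edge `a - b`; there are no loops and any two distinct vertices are
joined by at most one edge. -/
structure PDGraph (V : Type*) where
  dir : V → V → Prop
  undir : V → V → Prop
  undir_symm : ∀ a b, undir a b → undir b a
  undir_irrefl : ∀ a, ¬ undir a a
  dir_asymm : ∀ a b, dir a b → ¬ dir b a
  not_undir_of_dir : ∀ a b, dir a b → ¬ undir a b

namespace PDGraph

variable {V : Type*}

/-- Two vertices are adjacent (neighbors of each other) if they are connected by an edge. -/
def Adj (G : PDGraph V) (a b : V) : Prop := G.dir a b ∨ G.dir b a ∨ G.undir a b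

/-- The set of children of `x`. -/
def ch (G : PDGraph V) (x : V) : Set V := {y | G.dir x y}

/-- `p` is a path from `x` to `y`: a sequence of distinct vertices, starting at `x` and ending at
`y`, any two consecutive ones being adjacent. -/
def IsPath (G : PDGraph V) (p : List V) (x y : V) : Prop :=
  p.Nodup ∧ p.IsChain G.Adj ∧ p.head? = some x ∧ p.getLast? = some y

/-- Along `p`, no edge points backwards. -/
def PartiallyDirected (G : PDGraph V) (p : List V) : Prop := p.IsChain (fun a b => ¬ G.dir b a)

/-- Along `p`, every edge is directed and points forwards. -/
def Directed (G : PDGraph V) (p : List V) : Prop := p.IsChain G.dir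

/-- No edge of `G` joins two nonconsecutive vertices of `p`. -/
def Chordless (G : PDGraph V) (p : List V) : Prop :=
  ∀ (i j : ℕ) (hij : i + 1 < j) (hj : j < p.length),
    ¬ G.Adj (p[i]'(by omega)) (p[j]'hj)

/-- There is no directed cycle, i.e. no directed path from some `x` to some `y` together with a
directed edge `y → x`. -/
def Acyclic (G : PDGraph V) : Prop :=
  ∀ (p : List V) (x y : V), G.IsPath p x y → G.Directed p → ¬ G.dir y x

/-- A partially directed acyclic graph. -/
def IsPDAG (G : PDGraph V) : Prop := G.Acyclic

/-- A directed acyclic graph: all edges are directed, and there are no directed cycles. -/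
def IsDAG (G : PDGraph V) : Prop := (∀ a b, ¬ G.undir a b) ∧ G.Acyclic

/-- `x` is an ancestor of `y` (and `y` a descendant of `x`). -/
def IsAncestor (G : PDGraph V) (x y : V) : Prop :=
  x = y ∨ ∃ p, G.IsPath p x y ∧ G.Directed p

/-- The set of descendants of `x`. -/
def de (G : PDGraph V) (x : V) : Set V := {y | G.IsAncestor x y}

/-- `x` is a direct cause of `y`, i.e. a parent of `y`. -/
def IsDirectCause (G : PDGraph V) (x y : V) : Prop := G.dir x y

/-- `x` is a cause of `y`, i.e. an ancestor of `y`. -/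
def IsCause (G : PDGraph V) (x y : V) : Prop := G.IsAncestor x y

/-- In a DAG, the path `p` is blocked by `Z`: some non-collider of `p` is in `Z`, or some collider
of `p` has no descendant in `Z`. Here `a, b, c` are consecutive on `p`, so that `b` is not an
endpoint. -/
def Blocked (G : PDGraph V) (p : List V) (Z : Set V) : Prop :=
  ∃ a b c, [a, b, c] <:+: p ∧
    (((G.dir b a ∨ G.dir b c) ∧ b ∈ Z) ∨ ((G.dir a b ∧ G.dir c b) ∧ Disjoint (G.de b) Z))

/-- In a DAG, `A` and `B` are d-separated by `Z`. -/
def DSep (G : PDGraph V) (A B Z : Set V) : Prop :=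
  ∀ x ∈ A, ∀ y ∈ B, ∀ p, G.IsPath p x y → G.Blocked p Z

/-- Two DAGs are Markov equivalent if they induce the same d-separation relations. -/
def MarkovEquiv (G H : PDGraph V) : Prop :=
  ∀ A B Z : Set V, Disjoint A B → Disjoint A Z → Disjoint B Z → (G.DSep A B Z ↔ H.DSep A B Z)

/-- `S` is the completed PDAG of the DAG `G`: a PDAG with the skeleton of `G` whose directed edges
are those common to all DAGs that are Markov equivalent to `G`. -/
def IsCPDAGOf (S G : PDGraph V) : Prop :=
  S.IsPDAG ∧ (∀ a b, S.Adj a b ↔ G.Adj a b) ∧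
    ∀ a b, S.dir a b ↔ ∀ H : PDGraph V, H.IsDAG → MarkovEquiv G H → H.dir a b

/-- `S` is a CPDAG. -/
def IsCPDAG (S : PDGraph V) : Prop := ∃ G : PDGraph V, G.IsDAG ∧ IsCPDAGOf S G

/-- The Markov equivalence class `[S]` represented by a CPDAG `S`: all DAGs that are Markov
equivalent to a DAG whose CPDAG is `S`. -/
def markovClass (S : PDGraph V) : Set (PDGraph V) :=
  {H | H.IsDAG ∧ ∃ G : PDGraph V, G.IsDAG ∧ IsCPDAGOf S G ∧ MarkovEquiv G H}

/-- The critical set of `x` with respect to `y` in `S`: all neighbors of `x` lying on at least one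
chordless partially directed path from `x` to `y`. -/
def criticalSet (S : PDGraph V) (x y : V) : Set V :=
  {c | S.Adj x c ∧ ∃ p, S.IsPath p x y ∧ S.PartiallyDirected p ∧ S.Chordless p ∧ c ∈ p}

theorem not_adj_self (G : PDGraph V) (a : V) : ¬ G.Adj a a := by
  rintro (h | h | h)
  · exact G.dir_asymm a a h h
  · exact G.dir_asymm a a h h
  · exact G.undir_irrefl a h

theorem self_notMem_criticalSet (S : PDGraph V) (x y : V) : x ∉ S.criticalSet x y :=
  fun h => S.not_adj_self x h.1

theorem notMem_singleton_of_mem_criticalSet (S : PDGraph V) {x y c : V}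
    (h : c ∈ S.criticalSet x y) : c ∉ ({x} : Set V) := by
  rintro rfl
  exact S.self_notMem_criticalSet _ y h

end PDGraph

/-- A direct causal clause over `V`, with a tail and a set of heads not containing the tail. -/
structure DirectCausalClause (V : Type*) where
  tail : V
  heads : Set V
  tail_notMem : tail ∉ heads

/-- The clause holds for the DAG `G`: some head is a child of the tail. -/
def DirectCausalClause.Holds {V : Type*} (κ : DirectCausalClause V) (G : PDGraph V) : Prop :=
  (κ.heads ∩ G.ch κ.tail).Nonempty

namespace PDGraph

variable {V : Type*} {G H S : PDGraph V} {a b c : V}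

/-! Everything reduces to (ii): `x` causes `y` in `G` iff some critical vertex is a child of `x`.
Forwards, shortcutting a directed path makes it chordless. As `S` has the skeleton of `G` and its
arrows hold in `G`, the path is chordless and partially directed in `S`, so its second vertex is
critical. Backwards, a critical vertex is the second vertex of a chordless partially directed path,
and the orientation of the first edge propagates: the first edge pointing backwards in `G` would
create a v-structure, whose arrows `S` retains. This rests on Markov equivalent DAGs sharing
skeleton and v-structures, proved by separating nonadjacent vertices by parent sets. Part (iii)
negates (ii), each edge of `G` at `x` having one of two directions. -/

theorem Adj.symm (h : G.Adj a b) : G.Adj b a := by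
  rcases h with h | h | h
  · exact Or.inr (Or.inl h)
  · exact Or.inl h
  · exact Or.inr (Or.inr (G.undir_symm _ _ h))

theorem IsDAG.dir_or_dir (hG : G.IsDAG) (h : G.Adj a b) : G.dir a b ∨ G.dir b a := by
  rcases h with h | h | h
  · exact Or.inl h
  · exact Or.inr h
  · exact absurd h (hG.1 a b)

/-! ### Directed paths and ancestors -/

theorem reflTransGen_of_directed {l : List V} (h : G.Directed (a :: l))
    (hb : (a :: l).getLast? = some b) : Relation.ReflTransGen G.dir a b := by
  induction l generalizing a with
  | nil =>
    obtain rfl : a = b := by simpa using hb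
    exact .refl
  | cons w l ih =>
    obtain ⟨h1, h2⟩ := List.isChain_cons_cons.1 h
    exact .head h1 (ih h2 (by simpa using hb))

theorem IsAncestor.reflTransGen (h : G.IsAncestor a b) : Relation.ReflTransGen G.dir a b := by
  rcases h with rfl | ⟨p, ⟨-, -, ha, hb⟩, hd⟩
  · exact .refl
  · cases p with
    | nil => simp at ha
    | cons u l =>
      obtain rfl : u = a := by simpa using ha
      exact reflTransGen_of_directed hd hb

/-- Every vertex reachable along directed edges is reached by a directed path. -/
theorem exists_directed_path (h : Relation.ReflTransGen G.dir a b) :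
    ∃ p, G.IsPath p a b ∧ G.Directed p := by
  induction h using Relation.ReflTransGen.head_induction_on with
  | refl => exact ⟨[b], ⟨by simp, by simp, by simp, by simp⟩, by simp [Directed]⟩
  | @head u w huw _ ih =>
    obtain ⟨p, ⟨hn, hc, hw, hb⟩, hd⟩ := ih
    by_cases hu : u ∈ p
    · obtain ⟨l, r, rfl⟩ := List.append_of_mem hu
      refine ⟨u :: r, ⟨hn.of_append_right, hc.right_of_append, rfl, ?_⟩, ?_⟩
      · simpa using hb
      · exact List.IsChain.right_of_append hd
    · cases p with
      | nil => simp at hw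
      | cons w' l =>
        obtain rfl : w' = w := by simpa using hw
        refine ⟨u :: w' :: l, ⟨List.nodup_cons.2 ⟨hu, hn⟩,
          List.isChain_cons_cons.2 ⟨Or.inl huw, hc⟩, rfl, by simpa using hb⟩,
          List.isChain_cons_cons.2 ⟨huw, hd⟩⟩

theorem isAncestor_iff : G.IsAncestor a b ↔ Relation.ReflTransGen G.dir a b :=
  ⟨IsAncestor.reflTransGen, fun h => Or.inr (exists_directed_path h)⟩

theorem Acyclic.not_transGen (hG : G.Acyclic) : ¬ Relation.TransGen G.dir a a := by
  intro h
  obtain ⟨c, hac, hca⟩ := Relation.TransGen.tail'_iff.1 h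
  obtain ⟨p, hp, hd⟩ := exists_directed_path hac
  exact hG p a c hp hd hca

theorem Acyclic.nodup_of_directed (hG : G.Acyclic) {p : List V} (hp : G.Directed p) :
    p.Nodup := by
  have h : p.IsChain (Relation.TransGen G.dir) := hp.imp fun _ _ => .single
  refine h.pairwise.imp ?_
  rintro u _ hu rfl
  exact hG.not_transGen hu

theorem chordless_cons_cons {l : List V} :
    G.Chordless (a :: b :: l) ↔ (∀ u ∈ l, ¬ G.Adj a u) ∧ G.Chordless (b :: l) := by
  constructor
  · intro h
    refine ⟨fun u hu => ?_, fun i j hij hj => ?_⟩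
    · obtain ⟨n, hn, rfl⟩ := List.mem_iff_getElem.1 hu
      exact h 0 (n + 2) (by omega) (by simpa using hn)
    · exact h (i + 1) (j + 1) (by omega) (by simpa using hj)
  · rintro ⟨h1, h2⟩ i j hij hj
    obtain ⟨j, rfl⟩ : ∃ k, j = k + 2 := ⟨j - 2, by omega⟩
    cases i with
    | zero => exact h1 _ (List.getElem_mem (by simpa using hj))
    | succ i => exact h2 i (j + 1) (by omega) (by simpa using hj)

theorem chordless_singleton : G.Chordless [a] := by
  intro i j hij hj
  simp only [List.length_singleton] at hj
  omega

/-- Jump from `a` to the last vertex of `p` that is a child of `a`. A chord from `a` to a later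
vertex would be a later child, or would point back to `a` and close a cycle. -/
theorem IsDAG.exists_chordless_cons (hG : G.IsDAG) (p : List V) (hd : G.Directed p)
    (hc : G.Chordless p) (hb : p.getLast? = some b) (ha : ∃ v ∈ p, G.dir a v) :
    ∃ q, G.Directed (a :: q) ∧ G.Chordless (a :: q) ∧ (a :: q).getLast? = some b := by
  induction p with
  | nil => simp at hb
  | cons h t ih =>
    by_cases ht : ∃ v ∈ t, G.dir a v
    · cases t with
      | nil => simp at ht
      | cons w t =>
        exact ih (List.isChain_cons_cons.1 hd).2 (chordless_cons_cons.1 hc).2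
          (by simpa using hb) ht
    · have hah : G.dir a h := by
        obtain ⟨v, hv, hav⟩ := ha
        rcases List.mem_cons.1 hv with rfl | hv
        · exact hav
        · exact absurd ⟨v, hv, hav⟩ ht
      have hdir : G.Directed (a :: h :: t) := List.isChain_cons_cons.2 ⟨hah, hd⟩
      refine ⟨h :: t, hdir, chordless_cons_cons.2 ⟨fun u hu hau => ?_, hc⟩, by simpa using hb⟩
      rcases hG.dir_or_dir hau with hau | hua
      · exact ht ⟨u, hu, hau⟩
      · have hch : (a :: h :: t).IsChain (Relation.TransGen G.dir) :=
          List.IsChain.imp (fun _ _ => .single) hdir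
        exact hG.2.not_transGen
          ((List.rel_of_pairwise_cons hch.pairwise (List.mem_cons_of_mem _ hu)).tail hua)

/-- In a DAG, an ancestor of `b` is joined to `b` by a chordless directed path. -/
theorem IsDAG.exists_chordless_directed (hG : G.IsDAG) (h : Relation.ReflTransGen G.dir a b) :
    ∃ q, G.Directed (a :: q) ∧ G.Chordless (a :: q) ∧ (a :: q).getLast? = some b := by
  induction h using Relation.ReflTransGen.head_induction_on with
  | refl => exact ⟨[], by simp [Directed], chordless_singleton, rfl⟩
  | @head u w huw _ ih =>
    obtain ⟨q, hd, hc, hb⟩ := ih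
    exact IsDAG.exists_chordless_cons hG (w :: q) hd hc hb ⟨w, by simp, huw⟩

/-! ### Markov equivalent DAGs have the same skeleton and the same v-structures -/

/-- A path that starts with `a → b` and does not end at a descendant of `a` has a collider that
is a descendant of `a`. -/
theorem IsDAG.exists_collider (hG : G.IsDAG) {y : V} (l : List V) (hab : G.dir a b)
    (hc : (a :: b :: l).IsChain G.Adj) (hy : (a :: b :: l).getLast? = some y)
    (hay : ¬ Relation.TransGen G.dir a y) :
    ∃ u v w, [u, v, w] <:+: a :: b :: l ∧ G.dir u v ∧ G.dir w v ∧ Relation.TransGen G.dir a v := by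
  induction l generalizing a b with
  | nil =>
    obtain rfl : b = y := by simpa using hy
    exact absurd (.single hab) hay
  | cons c l ih =>
    have hc' := (List.isChain_cons_cons.1 hc).2
    rcases hG.dir_or_dir (List.isChain_cons_cons.1 hc').1 with hbc | hcb
    · obtain ⟨u, v, w, hin, huv, hwv, hbv⟩ :=
        ih hbc hc' (by simpa using hy) fun h => hay (.head hab h)
      exact ⟨u, v, w, hin.trans (List.suffix_cons _ _).isInfix, huv, hwv, .head hab hbv⟩
    · exact ⟨a, b, c, ⟨[], l, rfl⟩, hab, hcb, .single hab⟩

/-- In a DAG, a vertex is d-separated by its parents from each nonadjacent nondescendant. -/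
theorem IsDAG.dSep_parents (hG : G.IsDAG) (hne : a ≠ b) (hab : ¬ G.Adj a b)
    (hanc : ¬ Relation.TransGen G.dir a b) : G.DSep {a} {b} {z | G.dir z a} := by
  rintro _ rfl _ rfl p ⟨-, hc, ha, hb⟩
  rename_i x y
  match p with
  | [] => simp at ha
  | [u] =>
    simp only [List.head?_cons, List.getLast?_singleton, Option.some.injEq] at ha hb
    exact absurd (ha.symm.trans hb) hne
  | u :: w :: l =>
    obtain rfl : u = x := by simpa using ha
    have huw := (List.isChain_cons_cons.1 hc).1
    rcases hG.dir_or_dir huw with h | h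
    · obtain ⟨r, s, t, hin, hrs, hts, hus⟩ := hG.exists_collider l h hc hb hanc
      refine ⟨r, s, t, hin, Or.inr ⟨⟨hrs, hts⟩, Set.disjoint_left.2 fun z hz hzu => ?_⟩⟩
      -- A descendant of the collider that is a parent of `u` would close a cycle through `u`.
      exact hG.2.not_transGen ((hus.trans_left (IsAncestor.reflTransGen hz)).tail hzu)
    · cases l with
      | nil =>
        obtain rfl : w = y := by simpa using hb
        exact absurd huw hab
      | cons v l => exact ⟨u, w, v, ⟨[], l, rfl⟩, Or.inl ⟨Or.inl h, h⟩⟩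

theorem not_dSep_of_adj (h : G.Adj a b) (Z : Set V) : ¬ G.DSep {a} {b} Z := by
  have hne : a ≠ b := by
    rintro rfl
    exact G.not_adj_self _ h
  intro hs
  obtain ⟨u, v, w, hin, -⟩ := hs a rfl b rfl [a, b]
    ⟨by simpa using hne, by simpa using h, rfl, rfl⟩
  -- A path with two vertices has no interior vertex that could block it.
  have := hin.length_le
  simp at this

theorem MarkovEquiv.symm (h : MarkovEquiv G H) : MarkovEquiv H G :=
  fun A B Z h1 h2 h3 => (h A B Z h1 h2 h3).symm

theorem MarkovEquiv.dSep_parents (h : MarkovEquiv G H) (hG : G.IsDAG) (hne : a ≠ b)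
    (hab : ¬ G.Adj a b) (hanc : ¬ Relation.TransGen G.dir a b) :
    H.DSep {a} {b} {z | G.dir z a} := by
  refine (h _ _ _ ?_ ?_ ?_).1 (hG.dSep_parents hne hab hanc)
  · simpa using hne
  · simpa using fun h => G.dir_asymm _ _ h h
  · simpa using fun h => hab (Or.inr (Or.inl h))

/-- By acyclicity, one of two vertices nonadjacent in `G` is not an ancestor of the other, so its
parents separate them; adjacent vertices are never separated. -/
theorem MarkovEquiv.adj_of_adj (h : MarkovEquiv G H) (hG : G.IsDAG) (hab : H.Adj a b) :
    G.Adj a b := by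
  have hne : a ≠ b := by
    rintro rfl
    exact H.not_adj_self _ hab
  by_contra hn
  by_cases hanc : Relation.TransGen G.dir a b
  · refine not_dSep_of_adj hab.symm _
      (h.dSep_parents hG hne.symm (fun h => hn h.symm) fun h => ?_)
    exact hG.2.not_transGen (hanc.trans h)
  · exact not_dSep_of_adj hab _ (h.dSep_parents hG hne hn hanc)

theorem MarkovEquiv.adj_iff (h : MarkovEquiv G H) (hG : G.IsDAG) (hH : H.IsDAG) :
    G.Adj a b ↔ H.Adj a b :=
  ⟨h.symm.adj_of_adj hH, h.adj_of_adj hG⟩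

/-- The parents of `a` in `G` do not include its child `c`, yet they block the path `a, c, b` in
`H`; so `c` must be a collider there. -/
theorem MarkovEquiv.vStructure_of_not_transGen (h : MarkovEquiv G H) (hG : G.IsDAG)
    (hH : H.IsDAG) (hne : a ≠ b) (hab : ¬ G.Adj a b) (hac : G.dir a c) (hbc : G.dir b c)
    (hanc : ¬ Relation.TransGen G.dir a b) : H.dir a c ∧ H.dir b c := by
  have hacn : a ≠ c := by
    rintro rfl
    exact G.dir_asymm _ _ hac hac
  have hbcn : b ≠ c := by
    rintro rfl
    exact G.dir_asymm _ _ hbc hbc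
  obtain ⟨u, v, w, hin, hblock⟩ := h.dSep_parents hG hne hab hanc a rfl b rfl [a, c, b]
    ⟨by simp [hacn, hne, hbcn.symm], by
      simp only [List.isChain_cons_cons, List.isChain_singleton, and_true]
      exact ⟨(h.adj_iff hG hH).1 (Or.inl hac), (h.adj_iff hG hH).1 (Or.inr (Or.inl hbc))⟩,
      rfl, rfl⟩
  have heq : [u, v, w] = [a, c, b] := hin.eq_of_length rfl
  simp only [List.cons.injEq, and_true] at heq
  obtain ⟨rfl, rfl, rfl⟩ := heq
  rcases hblock with ⟨-, hz⟩ | ⟨hcol, -⟩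
  · exact absurd hz (G.dir_asymm _ _ hac)
  · exact hcol

/-- Markov equivalent DAGs have the same v-structures. -/
theorem MarkovEquiv.vStructure (h : MarkovEquiv G H) (hG : G.IsDAG)
    (hH : H.IsDAG) (hne : a ≠ b) (hab : ¬ G.Adj a b) (hac : G.dir a c) (hbc : G.dir b c) :
    H.dir a c ∧ H.dir b c := by
  by_cases hanc : Relation.TransGen G.dir a b
  · exact (h.vStructure_of_not_transGen hG hH hne.symm (fun h => hab h.symm) hbc hac
      fun h => hG.2.not_transGen (hanc.trans h)).symm
  · exact h.vStructure_of_not_transGen hG hH hne hab hac hbc hanc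

/-! ### A CPDAG and the DAGs it represents -/

theorem dir_of_mem_markovClass (hG : G ∈ S.markovClass) (h : S.dir a b) : G.dir a b := by
  obtain ⟨hG, G₀, -, hS, he⟩ := hG
  exact (hS.2.2 a b).1 h G hG he

theorem adj_iff_of_mem_markovClass (hG : G ∈ S.markovClass) : S.Adj a b ↔ G.Adj a b := by
  obtain ⟨hG, G₀, hG₀, hS, he⟩ := hG
  exact (hS.2.1 a b).trans (he.adj_iff hG₀ hG)

/-- The edges of a v-structure are directed in the CPDAG. -/
theorem dir_of_vStructure (hG : G ∈ S.markovClass) (hne : a ≠ b) (hab : ¬ G.Adj a b)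
    (hac : G.dir a c) (hbc : G.dir b c) : S.dir b c := by
  obtain ⟨hG, G₀, hG₀, hS, he⟩ := hG
  refine (hS.2.2 b c).2 fun H hH hGH => ?_
  obtain ⟨hac₀, hbc₀⟩ := he.symm.vStructure hG hG₀ hne hab hac hbc
  -- The v-structure passes from `G` to `G₀`, and from there to every equivalent `H`.
  exact (hGH.vStructure hG₀ hH hne (fun h => hab ((he.adj_iff hG₀ hG).1 h)) hac₀ hbc₀).2

/-- If the first edge of a chordless partially directed path of the CPDAG points forwards in a
DAG of the class, then so do all its edges. -/
theorem directed_of_chordless (hG : G ∈ S.markovClass) (l : List V) (hab : G.dir a b)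
    (hn : (a :: b :: l).Nodup) (hadj : (a :: b :: l).IsChain S.Adj)
    (hpd : S.PartiallyDirected (a :: b :: l)) (hc : S.Chordless (a :: b :: l)) :
    G.Directed (a :: b :: l) := by
  induction l generalizing a b with
  | nil => simpa [Directed] using hab
  | cons c l ih =>
    obtain ⟨hac, hc'⟩ := chordless_cons_cons.1 hc
    have hadj' := (List.isChain_cons_cons.1 hadj).2
    have hpd' := (List.isChain_cons_cons.1 hpd).2
    refine List.isChain_cons_cons.2 ⟨hab, ih ?_ (List.nodup_cons.1 hn).2 hadj' hpd' hc'⟩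
    rcases hG.1.dir_or_dir
      ((adj_iff_of_mem_markovClass hG).1 (List.isChain_cons_cons.1 hadj').1) with h | h
    · exact h
    · refine absurd (dir_of_vStructure hG ?_ ?_ hab h) (List.isChain_cons_cons.1 hpd').1
      · rintro rfl
        simp at hn
      · exact fun h => hac c (by simp) ((adj_iff_of_mem_markovClass hG).2 h)

theorem isCause_iff_exists_mem_criticalSet (hG : G ∈ S.markovClass) {x y : V} (hxy : x ≠ y) :
    G.IsCause x y ↔ ∃ c ∈ S.criticalSet x y, G.dir x c := by
  constructor
  · intro h
    obtain ⟨q, hd, hc, hy⟩ := hG.1.exists_chordless_directed (IsAncestor.reflTransGen h)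
    cases q with
    | nil => exact absurd (by simpa using hy) hxy
    | cons c q =>
      have hxc : G.dir x c := (List.isChain_cons_cons.1 hd).1
      refine ⟨c, ⟨(adj_iff_of_mem_markovClass hG).2 (Or.inl hxc), x :: c :: q,
        ⟨hG.1.2.nodup_of_directed hd, ?_, rfl, hy⟩, ?_, ?_, by simp⟩, hxc⟩
      · exact List.IsChain.imp
          (fun _ _ h => (adj_iff_of_mem_markovClass hG).2 (Or.inl h)) hd
      · exact List.IsChain.imp
          (fun _ _ h h' => G.dir_asymm _ _ h (dir_of_mem_markovClass hG h')) hd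
      · exact fun i j hij hj h => hc i j hij hj ((adj_iff_of_mem_markovClass hG).1 h)
  · rintro ⟨c, ⟨hxc, p, ⟨hn, hadj, hx, hy⟩, hpd, hc, hcp⟩, hdir⟩
    match p with
    | [] => simp at hx
    | [u] =>
      simp only [List.head?_cons, List.getLast?_singleton, Option.some.injEq] at hx hy
      exact absurd (hx.symm.trans hy) hxy
    | u :: w :: l =>
      obtain rfl : u = x := by simpa using hx
      -- On a chordless path, the only neighbor of the first vertex is the second.
      obtain rfl : c = w := by
        rcases List.mem_cons.1 hcp with rfl | hcp
        · exact absurd hxc (S.not_adj_self _)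
        rcases List.mem_cons.1 hcp with rfl | hcp
        · rfl
        · exact absurd hxc ((chordless_cons_cons.1 hc).1 c hcp)
      exact isAncestor_iff.2
        (reflTransGen_of_directed (directed_of_chordless hG l hdir hn hadj hpd hc) hy)

end PDGraph

theorem mainTheorem4 {V : Type*} [Finite V] (S : PDGraph V) (hS : S.IsCPDAG)
    (x y : V) (hxy : x ≠ y) (G : PDGraph V) (hG : G ∈ S.markovClass) :
    (G.IsDirectCause x y ↔
      (DirectCausalClause.mk x {y} (by simpa using hxy)).Holds G) ∧
    (G.IsCause x y ↔
      (DirectCausalClause.mk x (S.criticalSet x y) (S.self_notMem_criticalSet x y)).Holds G) ∧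
    (¬ G.IsCause x y ↔
      ∀ (c : V) (hc : c ∈ S.criticalSet x y),
        (DirectCausalClause.mk c {x} (S.notMem_singleton_of_mem_criticalSet hc)).Holds G) := by
  have key := PDGraph.isCause_iff_exists_mem_criticalSet hG hxy
  refine ⟨?_, key, ?_⟩
  · simp [DirectCausalClause.Holds, PDGraph.IsDirectCause, PDGraph.ch]
  · simp only [DirectCausalClause.Holds, Set.singleton_inter_nonempty, PDGraph.ch,
      Set.mem_ofPred_eq, key, not_exists, not_and]
    refine forall₂_congr fun c hc => ⟨fun h => ?_, G.dir_asymm _ _⟩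
    exact (hG.1.dir_or_dir ((PDGraph.adj_iff_of_mem_markovClass hG).1 hc.1)).resolve_left h
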